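/- Let $X$ be a metric space, with metric $d$, whose topology is locally compact and separable, and let $\mu$ be a nonzero positive regular measure on the Borel $\sigma$-algebra of $X$ (or on its completion) that is finite on compact sets. Let $T:X\to X$ be an invertible measure-preserving transformation (a measurable bijection with measurable inverse that preserves $\mu$). Assume that $T$ is aperiodic, i.e. that the set of its periodic points $\{x : T^m x=x \text{ for some } m\ge 1\}$ has $\mu$-measure zero, and that $T$ is uniformly rigid along a sequence $(n_k)_{k\ge 1}$ of natural numbers, i.e. $n_k\to\infty$ and $d(T^{n_k}x,x)\to 0$ uniformly in $x\in X$ as $k\to\infty$. Let $U$ be the unitary operator $Uf=f\circ T$ on the complex Hilbert space $L^2(X,\mu)$, and let $I$ be the identity operator. Then the powers $U^{n_k}$ do not converge to $I$ in operator norm as $k\to\infty$, and neither do the Cesàro averages $$\frac1K\sum_{k=1}^{K}U^{n_k}$$ as $K\to\infty$. -/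

import Mathlib

open MeasureTheory Filter Topology

/-- `T` is uniformly rigid along the sequence `n`: `n k → ∞` and
`d(T^{n k} x, x) → 0` uniformly in `x ∈ X`. -/
def UniformlyRigidAlong {X : Type*} [MetricSpace X] (T : X → X) (n : ℕ → ℕ) : Prop :=
  Tendsto n atTop atTop ∧ ∀ ε : ℝ, 0 < ε → ∀ᶠ k in atTop, ∀ x : X, dist (T^[n k] x) x < ε

/-- `T` is aperiodic: the set of its periodic points is `μ`-null. -/
def Aperiodic {X : Type*} [MeasurableSpace X] (T : X → X) (μ : Measure X) : Prop :=
  ∀ᵐ x ∂μ, x ∉ Function.periodicPts T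

/-- The operator `U : f ↦ f ∘ T` on the complex space `L²(X, μ)`. -/
noncomputable def koopman {X : Type*} [MeasurableSpace X] {μ : Measure X} (T : X → X)
    (hT : MeasurePreserving T μ μ) : Lp ℂ 2 μ →L[ℂ] Lp ℂ 2 μ :=
  (Lp.compMeasurePreservingₗᵢ ℂ T hT).toContinuousLinearMap

/-- The averages `(1 / K) ∑ U^{n k}` over the first `K` terms of the sequence `n`. -/
noncomputable def cesaroAverage {E : Type*} [NormedAddCommGroup E] [NormedSpace ℂ E]
    (U : E →L[ℂ] E) (n : ℕ → ℕ) (K : ℕ) : E →L[ℂ] E :=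
  (K : ℂ)⁻¹ • ∑ k ∈ Finset.range K, U ^ n k

/-! Norm convergence of the powers implies that of their Cesàro averages, so only the averages need
an argument. For each `K`, aperiodicity yields a set `B` of positive finite measure disjoint from
its preimages under the finitely many nontrivial `T^[n k]`, `k < K`. Its indicator `v` is orthogonal
to every `U ^ n k v` with `n k > 0`, so the average moves `v` by a fixed proportion of its norm. `B`
may depend on `K` because the limit is in operator norm. -/

/-- A measurable self-map without fixed points (almost everywhere) displaces some subset of
positive measure of any given set of positive measure. -/
theorem exists_subset_disjoint_preimage {X : Type*} [TopologicalSpace X] [T1Space X]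
    [SecondCountableTopology X] [MeasurableSpace X] [OpensMeasurableSpace X]
    {μ : Measure X} {f : X → X} (hf : Measurable f) (hfix : ∀ᵐ x ∂μ, f x ≠ x)
    {A : Set X} (hA : MeasurableSet A) (hpos : μ A ≠ 0) :
    ∃ B ⊆ A, MeasurableSet B ∧ μ B ≠ 0 ∧ Disjoint B (f ⁻¹' B) := by
  by_contra! h
  -- Points of `A ∩ V` that `f` sends out of `V` form a displaced set; over a countable basis these
  -- sets cover the non-fixed points of `A`.
  have hnull : ∀ V ∈ TopologicalSpace.countableBasis X, μ (A ∩ (V ∩ f ⁻¹' Vᶜ)) = 0 := by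
    intro V hV
    by_contra hne
    have hVm : MeasurableSet V := (TopologicalSpace.isOpen_of_mem_countableBasis hV).measurableSet
    refine h _ Set.inter_subset_left (hA.inter (hVm.inter (hf hVm.compl))) hne ?_
    exact Set.disjoint_left.2 fun x hx hx' => hx.2.2 hx'.2.1
  have hU : μ (⋃ V ∈ TopologicalSpace.countableBasis X, A ∩ (V ∩ f ⁻¹' Vᶜ)) = 0 :=
    (measure_biUnion_null_iff (TopologicalSpace.countable_countableBasis X)).2 hnull
  refine hpos (measure_mono_null_ae ?_ hU)
  filter_upwards [hfix] with x hx hxA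
  obtain ⟨V, hV, hxV, hsub⟩ :=
    (TopologicalSpace.isBasis_countableBasis X).exists_subset_of_mem_open
      (show x ∈ ({f x}ᶜ : Set X) from fun h => hx h.symm) isOpen_compl_singleton
  exact Set.mem_biUnion hV ⟨hxA, hxV, fun h => hsub h rfl⟩

/-- An aperiodic map displaces, under any finite set of its positive iterates simultaneously, some
subset of positive measure of any given set of positive measure. -/
theorem exists_subset_disjoint_preimage_iterate {X : Type*} [TopologicalSpace X] [T1Space X]
    [SecondCountableTopology X] [MeasurableSpace X] [OpensMeasurableSpace X]
    {μ : Measure X} {T : X → X} (hT : Measurable T) (hap : Aperiodic T μ) (F : Finset ℕ)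
    {A : Set X} (hA : MeasurableSet A) (hpos : μ A ≠ 0) :
    ∃ B ⊆ A, MeasurableSet B ∧ μ B ≠ 0 ∧ ∀ m ∈ F, 0 < m → Disjoint B (T^[m] ⁻¹' B) := by
  induction F using Finset.induction_on with
  | empty => exact ⟨A, subset_rfl, hA, hpos, by simp⟩
  | insert m F _ ih =>
    obtain ⟨B, hBA, hB, hBpos, hdis⟩ := ih
    rcases m.eq_zero_or_pos with rfl | hm
    · exact ⟨B, hBA, hB, hBpos, by simpa using hdis⟩
    have hfix : ∀ᵐ x ∂μ, T^[m] x ≠ x := by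
      filter_upwards [hap] with x hx h
      exact hx (Function.mk_mem_periodicPts hm h)
    obtain ⟨C, hCB, hC, hCpos, hCdis⟩ :=
      exists_subset_disjoint_preimage (hT.iterate m) hfix hB hBpos
    refine ⟨C, hCB.trans hBA, hC, hCpos, fun j hj hj0 => ?_⟩
    rcases Finset.mem_insert.1 hj with rfl | hjF
    · exact hCdis
    -- Disjointness survives shrinking, so the iterates can be treated one at a time.
    · exact (hdis j hjF hj0).mono hCB (Set.preimage_mono hCB)

theorem koopman_pow_indicatorConstLp {X : Type*} [MeasurableSpace X] {μ : Measure X} {T : X → X}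
    (hT : MeasurePreserving T μ μ) (m : ℕ) {A : Set X} (hA : MeasurableSet A) (hfin : μ A ≠ ⊤)
    (c : ℂ) :
    (koopman T hT ^ m) (indicatorConstLp 2 hA hfin c) =
      indicatorConstLp 2 ((hT.iterate m).measurable hA)
        (by rwa [(hT.iterate m).measure_preimage hA.nullMeasurableSet]) c := by
  induction m with
  | zero => rfl
  | succ m ih =>
    rw [pow_succ', mul_apply_eq_comp, ih]
    exact Lp.indicatorConstLp_compMeasurePreserving _ _ c hT

/-- The Cesàro averages of powers of the Koopman operator along a sequence tending to infinity do
not converge to the identity in operator norm if the map is aperiodic. -/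
theorem not_tendsto_cesaroAverage_koopman {X : Type*} [TopologicalSpace X] [T1Space X]
    [SecondCountableTopology X] [MeasurableSpace X] [OpensMeasurableSpace X]
    {μ : Measure X} [IsLocallyFiniteMeasure μ] (hμ : μ ≠ 0) {T : X → X}
    (hT : MeasurePreserving T μ μ) (hap : Aperiodic T μ)
    {n : ℕ → ℕ} (hn : Tendsto n atTop atTop) :
    ¬ Tendsto (fun K => cesaroAverage (koopman T hT) n K) atTop (𝓝 1) := by
  intro hlim
  -- Terms with `n k = 0` are the identity; all of them have index below `N`.
  obtain ⟨N, hN⟩ := eventually_atTop.1 (hn.eventually_gt_atTop 0)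
  obtain ⟨K₀, hK₀⟩ := eventually_atTop.1
    (Metric.tendsto_nhds.1 hlim (1 / 2) (by norm_num))
  -- `2 * N ≤ K` keeps the weight `N / K` of the uncontrolled terms at most `1 / 2`.
  obtain ⟨K, hKK₀, hKN, hK⟩ : ∃ K : ℕ, K₀ ≤ K ∧ 2 * N ≤ K ∧ 0 < K :=
    ⟨K₀ + 2 * N + 1, by omega, by omega, by omega⟩
  obtain ⟨A, hA, hApos, hAfin⟩ : ∃ A : Set X, MeasurableSet A ∧ μ A ≠ 0 ∧ μ A < ⊤ := by
    let S := μ.finiteSpanningSetsInOpen'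
    obtain ⟨i, hi⟩ : ∃ i, μ (S.set i) ≠ 0 := by
      by_contra! h
      refine hμ (Measure.measure_univ_eq_zero.1 ?_)
      rw [← S.spanning]
      exact measure_iUnion_null h
    exact ⟨S.set i, (S.set_mem i).measurableSet, hi, S.finite i⟩
  obtain ⟨B, hBA, hB, hBpos, hdis⟩ := exists_subset_disjoint_preimage_iterate hT.measurable hap
    ((Finset.range K).image n) hA hApos
  have hBfin : μ B ≠ ⊤ := ((measure_mono hBA).trans_lt hAfin).ne
  set v : Lp ℂ 2 μ := indicatorConstLp 2 hB hBfin 1 with hv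
  have hvpos : 0 < ‖v‖ := by
    rw [hv, norm_indicatorConstLp (by norm_num) (by norm_num), norm_one, one_mul]
    exact Real.rpow_pos_of_pos (ENNReal.toReal_pos hBpos hBfin) _
  have hnorm : ∀ m, ‖(koopman T hT ^ m) v‖ ≤ ‖v‖ := by
    intro m
    induction m with
    | zero => rfl
    | succ m ih =>
      rw [pow_succ', mul_apply_eq_comp]
      exact ((Lp.compMeasurePreservingₗᵢ ℂ T hT).norm_map _).le.trans ih
  have horth : ∀ k ∈ Finset.range K, N ≤ k → inner ℂ v ((koopman T hT ^ n k) v) = 0 := by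
    intro k hk hNk
    have hd := hdis (n k) (Finset.mem_image_of_mem n hk) (hN k hNk)
    have hfin : μ (T^[n k] ⁻¹' B) ≠ ⊤ := by
      rwa [(hT.iterate _).measure_preimage hB.nullMeasurableSet]
    rw [hv, koopman_pow_indicatorConstLp,
      L2.inner_indicatorConstLp_indicatorConstLp hB _ hBfin hfin]
    simp [hd.inter_eq]
  have hsum : ‖∑ k ∈ Finset.range K, inner ℂ v ((koopman T hT ^ n k) v)‖ ≤ N * ‖v‖ ^ 2 := by
    have hNK : Finset.range N ⊆ Finset.range K := Finset.range_subset_range.2 (by omega)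
    rw [← Finset.sum_subset hNK fun k hk hkN => horth k hk (by simpa using hkN)]
    refine (norm_sum_le_of_le _ fun k _ => (norm_inner_le_norm _ _).trans
      (mul_le_mul_of_nonneg_left (hnorm _) (norm_nonneg v))).trans_eq ?_
    simp [sq]
  have havg : ‖inner ℂ v (cesaroAverage (koopman T hT) n K v)‖ ≤ ‖v‖ ^ 2 / 2 := by
    have hKR : (0 : ℝ) < K := by exact_mod_cast hK
    have hKNR : (2 * N : ℝ) ≤ K := by exact_mod_cast hKN
    simp only [cesaroAverage, smul_apply, sum_apply,
      inner_smul_right, inner_sum, norm_mul, norm_inv, Complex.norm_natCast]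
    rw [inv_mul_le_iff₀ hKR]
    nlinarith [sq_nonneg ‖v‖]
  have hclose : ‖inner ℂ v ((cesaroAverage (koopman T hT) n K - 1) v)‖ < ‖v‖ ^ 2 / 2 := by
    have h := hK₀ K hKK₀
    rw [dist_eq_norm] at h
    calc _ ≤ ‖v‖ * (‖cesaroAverage (koopman T hT) n K - 1‖ * ‖v‖) :=
          (norm_inner_le_norm _ _).trans
            (mul_le_mul_of_nonneg_left (ContinuousLinearMap.le_opNorm _ _) hvpos.le)
      _ < ‖v‖ * (1 / 2 * ‖v‖) := by gcongr
      _ = _ := by ring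
  have hself : ‖inner ℂ v v‖ = ‖v‖ ^ 2 := by
    rw [inner_self_eq_norm_sq_to_K]; simp
  rw [sub_apply, one_apply_eq_self, inner_sub_right] at hclose
  have := norm_sub_norm_le (inner ℂ v v) (inner ℂ v (cesaroAverage (koopman T hT) n K v))
  rw [norm_sub_rev] at hclose
  -- Together the two bounds give `‖v‖ ^ 2 < ‖v‖ ^ 2 / 2 + ‖v‖ ^ 2 / 2`.
  linarith

theorem tendsto_cesaroAverage {E : Type*} [NormedAddCommGroup E] [NormedSpace ℂ E]
    {U L : E →L[ℂ] E} {n : ℕ → ℕ} (h : Tendsto (fun k => U ^ n k) atTop (𝓝 L)) :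
    Tendsto (fun K => cesaroAverage U n K) atTop (𝓝 L) := by
  refine h.cesaro_smul.congr fun K => ?_
  rw [cesaroAverage, ← Complex.coe_smul]
  simp

/-- `OpensMeasurableSpace` together with `Measure.Regular` covers regular measures on the Borel
σ-algebra as well as on its completion. Limits of operators are in the operator norm. -/
theorem mainTheorem8 {X : Type*} [MetricSpace X] [LocallyCompactSpace X]
    [TopologicalSpace.SeparableSpace X] [MeasurableSpace X] [OpensMeasurableSpace X]
    (μ : Measure X) [μ.Regular] (hμ : μ ≠ 0)
    (T : X ≃ᵐ X) (hT : MeasurePreserving T μ μ) (hap : Aperiodic T μ)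
    (n : ℕ → ℕ) (hn : UniformlyRigidAlong T n) :
    ¬ Tendsto (fun k => koopman T hT ^ n k) atTop (𝓝 1) ∧
      ¬ Tendsto (fun K => cesaroAverage (koopman T hT) n K) atTop (𝓝 1) := by
  have h := not_tendsto_cesaroAverage_koopman hμ hT hap hn.1
  exact ⟨fun hlim => h (tendsto_cesaroAverage hlim), h⟩
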